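/- Let $n\ge 2$, let $\mathbb S^n$ be the unit sphere of $\mathbb R^{n+1}$, and let $f:\mathbb S^n\to\mathbb R$ be a positive Lipschitz function. Extend $f$ to $\mathbb R^{n+1}\setminus\{0\}$ as a positively homogeneous function of degree $-1$, that is, $f(x)=|x|^{-1}f(x/|x|)$. Suppose that $$\partial_\xi f(x+t\xi)-\partial_\xi f(x-t\xi)\le 0$$ for all $t>0$, all $\xi\in\mathbb S^n$ and all $x\in\mathbb R^{n+1}$ with $\langle x,\xi\rangle=0$ such that both directional derivatives exist, where $\partial_\xi f(y)=\frac{d}{ds}\big|_{s=0}f(y+s\xi)$. Then every solution $u\in C^2(\mathbb S^n)$ of the Christoffel equation $$\Delta_{\mathbb S^n}u+n\,u=f\quad\text{on }\mathbb S^n$$ is convex: the extension of $u$ to $\mathbb R^{n+1}$ that is positively homogeneous of degree $1$, $x\mapsto |x|\,u(x/|x|)$ (with value $0$ at $x=0$), is a convex function, and $\nabla^2u+u\,I\ge 0$ at every point of $\mathbb S^n$, where $\nabla^2 u$ is the covariant Hessian of $u$ on $\mathbb S^n$. -/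

import Mathlib

open scoped Manifold ContDiff Laplacian

/-- The Euclidean space `ℝ^(n+1)`. -/
abbrev Euc (n : ℕ) : Type := EuclideanSpace ℝ (Fin (n + 1))

/-- The unit sphere `S^n` in `ℝ^(n+1)`, with the metric and the manifold structure of Mathlib. -/
abbrev Sph (n : ℕ) : Type := Metric.sphere (0 : Euc n) 1

instance factFinrankEuc (n : ℕ) : Fact (Module.finrank ℝ (Euc n) = n + 1) :=
  ⟨by simp⟩

theorem inv_norm_smul_mem_unitSphere {n : ℕ} {x : Euc n} (hx : x ≠ 0) :
    ‖x‖⁻¹ • x ∈ Metric.sphere (0 : Euc n) 1 := by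
  simp [norm_smul, hx]

/-- The extension of a function `g` on `S^n` to `ℝ^(n+1) ∖ {0}` that is positively homogeneous of
degree `k`: `x ↦ |x|^k g(x/|x|)`. At the origin it is given the value `0`, which is the continuous
extension if `k > 0` and plays no role otherwise. -/
noncomputable def homExt {n : ℕ} (k : ℤ) (g : Sph n → ℝ) : Euc n → ℝ := by
  classical
  exact fun x => if hx : x = 0 then 0
    else ‖x‖ ^ k * g ⟨‖x‖⁻¹ • x, inv_norm_smul_mem_unitSphere hx⟩

/-- The Laplace-Beltrami operator of the round sphere: the Euclidean Laplacian, at `x ∈ S^n`, of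
the extension of `u` that is constant along rays. -/
noncomputable def sphLaplacian {n : ℕ} (u : Sph n → ℝ) (x : Sph n) : ℝ :=
  (Δ (homExt 0 u)) (x : Euc n)

/-- The covariant Hessian `∇²u(x)(ξ, η)` on the round sphere, for `ξ, η` tangent to `S^n` at `x`
(that is, orthogonal to `x`): the Euclidean second derivative of the extension of `u` that is
constant along rays. (Along a great circle `γ` from `x` the acceleration is radial, so that for
this extension the second derivative of `u ∘ γ` is the Euclidean Hessian on `γ'`.) -/
noncomputable def sphHessian {n : ℕ} (u : Sph n → ℝ) (x : Sph n) (ξ η : Euc n) : ℝ :=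
  iteratedFDeriv ℝ 2 (homExt 0 u) (x : Euc n) ![ξ, η]

/-- `u` is a (classical) solution of the Christoffel equation `Δ_{S^n} u + n u = f` on `S^n`. -/
structure IsChristoffelSolution {n : ℕ} (f u : Sph n → ℝ) : Prop where
  contMDiff : ContMDiff (𝓡 n) 𝓘(ℝ, ℝ) 2 u
  eqn : ∀ x : Sph n, sphLaplacian u x + n * u x = f x

/-- `u` is convex: its extension to `ℝ^(n+1)`, homogeneous of degree one, is a convex function, and
`∇²u + u I ≥ 0` at every point of `S^n`. -/
structure IsConvexOnSphere {n : ℕ} (u : Sph n → ℝ) : Prop where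
  convexOn : ConvexOn ℝ Set.univ (homExt 1 u)
  hessian_nonneg : ∀ (x : Sph n) (ξ : Euc n), inner ℝ ξ (x : Euc n) = 0 →
    0 ≤ sphHessian u x ξ ξ + u x * inner ℝ ξ ξ

/-- The condition `∂_ξ f(x + tξ) - ∂_ξ f(x - tξ) ≤ 0` for all `t > 0`, all unit vectors `ξ` and all
`x ⊥ ξ`, where `f` stands for the extension of degree `-1`. Since the directional derivatives of a
Lipschitz function need not exist everywhere, the inequality is required exactly where both of
them exist. -/
def ReflectionMonotone {n : ℕ} (f : Sph n → ℝ) : Prop :=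
  ∀ (t : ℝ) (ξ x : Euc n), 0 < t → ‖ξ‖ = 1 → inner ℝ ξ x = 0 →
    LineDifferentiableAt ℝ (homExt (-1) f) (x + t • ξ) ξ →
    LineDifferentiableAt ℝ (homExt (-1) f) (x - t • ξ) ξ →
    lineDeriv ℝ (homExt (-1) f) (x + t • ξ) ξ - lineDeriv ℝ (homExt (-1) f) (x - t • ξ) ξ ≤ 0

/-! Let `H` be the degree-one extension of `u` and `F` the degree `-1` extension of `f`. In these
terms the Christoffel equation is the Poisson equation `Δ H = F` off the origin
(`IsChristoffelSolution.laplacian_homExt_one`), and `∇²u + u I` at `x` is the Hessian of `H` on the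
tangent space (`sphHessian_add_eq_iteratedFDeriv`). The radial direction lies in the kernel of that
Hessian, so both claims reduce to `∂_ξ∂_ξ H(x) ≥ 0` for unit `ξ ⟂ x`.

Fix `ξ`, let `σ` be the reflection in `ξᗮ`, and put `w = ∂_ξ H - (∂_ξ H) ∘ σ`. Then `w` vanishes on
`ξᗮ`, is homogeneous of degree zero, and formally `Δ w = ∂_ξ F - (∂_ξ F) ∘ σ ≤ 0` on the half-space
`⟪ξ, y⟫ > 0`. A minimum principle on the hemisphere gives `w ≥ 0`
(`fderiv_le_fderiv_of_reflection_antitone`). The derivative of `w` at `x ∈ ξᗮ` in the direction `ξ`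
is `2 ∂_ξ∂_ξ H(x)`, which is therefore nonnegative.

Since `H` is only `C²`, `Δ w` need not exist. Symmetric difference quotients of `H` replace `∂_ξ H`,
and the hypothesis on `f` is used in integrated form: `t ↦ F(x + tξ) + F(x - tξ)` is antitone on
`(0, ∞)` (`ReflectionMonotone.add_homExt_antitone`). -/

open scoped Topology RealInnerProductSpace
open Filter Metric

/-! ### Second derivatives along lines -/

section SecondDerivative

variable {E : Type*} [NormedAddCommGroup E] [NormedSpace ℝ E]

theorem hasDerivAt_comp_line {f : E → ℝ} {x v : E} {s : ℝ} (hf : DifferentiableAt ℝ f (x + s • v)) :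
    HasDerivAt (fun r : ℝ => f (x + r • v)) (fderiv ℝ f (x + s • v) v) s := by
  have h1 : HasDerivAt (fun r : ℝ => x + r • v) v s := by
    simpa using ((hasDerivAt_id s).smul_const v).const_add x
  exact hf.hasFDerivAt.comp_hasDerivAt s h1

theorem ContDiffAt.eventually_differentiableAt_line {f : E → ℝ} {x : E} (hf : ContDiffAt ℝ 2 f x)
    (v : E) : ∀ᶠ s : ℝ in 𝓝 0, DifferentiableAt ℝ f (x + s • v) := by
  have hc : Tendsto (fun s : ℝ => x + s • v) (𝓝 0) (𝓝 x) := by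
    have : Continuous fun s : ℝ => x + s • v := by fun_prop
    simpa using this.tendsto 0
  exact hc.eventually ((hf.eventually (by simp)).mono fun y hy => hy.differentiableAt (by simp))

theorem ContDiffAt.hasDerivAt_fderiv_line {f : E → ℝ} {x : E} (hf : ContDiffAt ℝ 2 f x) (v : E) :
    HasDerivAt (fun s : ℝ => fderiv ℝ f (x + s • v) v) (iteratedFDeriv ℝ 2 f x ![v, v]) 0 := by
  have h1 : DifferentiableAt ℝ (fun y => fderiv ℝ f y v) (x + (0 : ℝ) • v) := by
    have : ContDiffAt ℝ 1 (fderiv ℝ f) x := hf.fderiv_right (by norm_num)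
    simpa using (this.differentiableAt (by simp)).clm_apply (differentiableAt_const v)
  have h2 := hasDerivAt_comp_line h1
  have h3 : DifferentiableAt ℝ (fderiv ℝ f) x :=
    (hf.fderiv_right (m := 1) (by norm_num)).differentiableAt (by simp)
  rw [iteratedFDeriv_two_apply]
  convert h2 using 1
  simp [fderiv_clm_apply h3 (differentiableAt_const v)]

/-- Reduces the explicit second derivatives below to one-variable calculus on a line. Diagonal
values suffice, since only Laplacians and quadratic forms are needed. -/
theorem ContDiffAt.iteratedFDeriv_two_eq_of_hasDerivAt {f : E → ℝ} {x v : E}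
    (hf : ContDiffAt ℝ 2 f x) {g : ℝ → ℝ} {c : ℝ}
    (hg : ∀ᶠ s : ℝ in 𝓝 0, HasDerivAt (fun r : ℝ => f (x + r • v)) (g s) s)
    (hc : HasDerivAt g c 0) : iteratedFDeriv ℝ 2 f x ![v, v] = c := by
  refine (hf.hasDerivAt_fderiv_line v).unique (hc.congr_of_eventuallyEq ?_)
  filter_upwards [hg, hf.eventually_differentiableAt_line v] with s hs hs'
  exact (hasDerivAt_comp_line hs').unique hs

/-- If the second derivative along `v` were negative, the point would also be a local maximum on
that line. The function would then be locally constant there, with second derivative zero. -/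
theorem IsLocalMin.iteratedFDeriv_two_nonneg {f : E → ℝ} {x : E} (hmin : IsLocalMin f x)
    (hf : ContDiffAt ℝ 2 f x) (v : E) : 0 ≤ iteratedFDeriv ℝ 2 f x ![v, v] := by
  by_contra! hneg
  have hc : Tendsto (fun s : ℝ => x + s • v) (𝓝 0) (𝓝 x) := by
    have : Continuous fun s : ℝ => x + s • v := by fun_prop
    simpa using this.tendsto 0
  set φ : ℝ → ℝ := fun s => f (x + s • v) with hφ
  have hev : ∀ᶠ s : ℝ in 𝓝 0, HasDerivAt φ (fderiv ℝ f (x + s • v) v) s :=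
    (hf.eventually_differentiableAt_line v).mono fun s hs => hasDerivAt_comp_line hs
  have hd : deriv φ =ᶠ[𝓝 0] fun s : ℝ => fderiv ℝ f (x + s • v) v := hev.mono fun s hs => hs.deriv
  have hφmin : IsLocalMin φ 0 := by
    have := hc.eventually hmin
    filter_upwards [this] with s hs
    simpa [hφ] using hs
  have hdd : HasDerivAt (deriv φ) (iteratedFDeriv ℝ 2 f x ![v, v]) 0 :=
    (hf.hasDerivAt_fderiv_line v).congr_of_eventuallyEq hd
  have hmax : IsLocalMax φ 0 := isLocalMax_of_deriv_deriv_neg (by rwa [hdd.deriv])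
    hφmin.deriv_eq_zero hev.self_of_nhds.continuousAt
  have hconst : φ =ᶠ[𝓝 0] fun _ => φ 0 := by
    filter_upwards [hφmin, hmax] with s h1 h2 using le_antisymm h2 h1
  have hz : deriv φ =ᶠ[𝓝 0] fun _ => 0 := by
    have := hconst.deriv
    simpa using this
  have := hz.deriv_eq
  rw [hdd.deriv] at this
  simp at this
  exact hneg.ne this

end SecondDerivative

/-! ### Homogeneous functions of degree zero and one -/

section InnerProduct

variable {E : Type*} [NormedAddCommGroup E] [InnerProductSpace ℝ E]

theorem IsLocalMin.laplacian_nonneg [FiniteDimensional ℝ E] {f : E → ℝ} {x : E}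
    (hmin : IsLocalMin f x) (hf : ContDiffAt ℝ 2 f x) : 0 ≤ (Δ f) x := by
  rw [InnerProductSpace.laplacian_eq_iteratedFDeriv_stdOrthonormalBasis]
  exact Finset.sum_nonneg fun i _ => hmin.iteratedFDeriv_two_nonneg hf _

/-- Euler's identity in degree zero. The target is a general space so that it also applies to the
derivative of a function homogeneous of degree one. -/
theorem fderiv_apply_self_of_homogeneous_zero {F : Type*} [NormedAddCommGroup F] [NormedSpace ℝ F]
    {U : E → F} {x : E}
    (hU : ∀ c : ℝ, 0 < c → U (c • x) = U x) (hd : DifferentiableAt ℝ U x) :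
    fderiv ℝ U x x = 0 := by
  have h1 : HasDerivAt (fun r : ℝ => x + r • x) x 0 := by
    simpa using ((hasDerivAt_id (0 : ℝ)).smul_const x).const_add x
  have h2 : HasDerivAt (fun r : ℝ => U (x + r • x)) (fderiv ℝ U x x) 0 := by
    refine HasFDerivAt.comp_hasDerivAt (0 : ℝ) ?_ h1
    simpa using hd.hasFDerivAt
  refine h2.unique ((hasDerivAt_const (0 : ℝ) (U x)).congr_of_eventuallyEq ?_)
  filter_upwards [lt_mem_nhds (show (-1 : ℝ) < 0 by norm_num)] with r hr
  have : x + r • x = (1 + r) • x := by rw [add_smul, one_smul]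
  rw [this, hU _ (by linarith)]

theorem hasDerivAt_norm_line {x v : E} {s : ℝ} (h : x + s • v ≠ 0) :
    HasDerivAt (fun r : ℝ => ‖x + r • v‖) ((⟪x, v⟫ + s * ‖v‖ ^ 2) / ‖x + s • v‖) s := by
  have h1 : HasDerivAt (fun r : ℝ => x + r • v) v s := by
    simpa using ((hasDerivAt_id s).smul_const v).const_add x
  have h2 := h1.norm_sq.sqrt (by simpa using h)
  simp only [Real.sqrt_sq (norm_nonneg _)] at h2
  convert h2 using 1
  rw [inner_add_left, real_inner_smul_left, real_inner_self_eq_norm_sq, mul_div_mul_left _ _ two_ne_zero]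

/-- The second derivative of the norm times a function at a point of the unit sphere. -/
theorem iteratedFDeriv_two_norm_mul {U : E → ℝ} {x : E} (hx : ‖x‖ = 1) (hU : ContDiffAt ℝ 2 U x)
    (v : E) :
    iteratedFDeriv ℝ 2 (fun y => ‖y‖ * U y) x ![v, v] =
      iteratedFDeriv ℝ 2 U x ![v, v] + 2 * (⟪x, v⟫ * fderiv ℝ U x v) +
        (‖v‖ ^ 2 - ⟪x, v⟫ ^ 2) * U x := by
  have hx0 : x ≠ 0 := by rintro rfl; simp at hx
  have hN : ContDiffAt ℝ 2 (fun y : E => ‖y‖) x := contDiffAt_norm ℝ hx0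
  refine (hN.mul hU).iteratedFDeriv_two_eq_of_hasDerivAt
    (g := fun s => (⟪x, v⟫ + s * ‖v‖ ^ 2) / ‖x + s • v‖ * U (x + s • v) +
      ‖x + s • v‖ * fderiv ℝ U (x + s • v) v) ?_ ?_
  · have hc : Tendsto (fun s : ℝ => x + s • v) (𝓝 0) (𝓝 x) := by
      have : Continuous fun s : ℝ => x + s • v := by fun_prop
      simpa using this.tendsto 0
    filter_upwards [hU.eventually_differentiableAt_line v, hc.eventually_ne hx0] with s hs hs0
    exact (hasDerivAt_norm_line hs0).mul (hasDerivAt_comp_line hs)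
  · have hx' : x + (0 : ℝ) • v ≠ 0 := by simpa using hx0
    have h1 := hasDerivAt_norm_line hx'
    have h2 : HasDerivAt (fun s : ℝ => U (x + s • v)) (fderiv ℝ U (x + (0 : ℝ) • v) v) 0 :=
      hasDerivAt_comp_line (by simpa using hU.differentiableAt (by simp))
    have h3 : HasDerivAt (fun s : ℝ => ⟪x, v⟫ + s * ‖v‖ ^ 2) (‖v‖ ^ 2) 0 := by
      simpa using ((hasDerivAt_id (0 : ℝ)).mul_const (‖v‖ ^ 2)).const_add ⟪x, v⟫
    have h4 := ((h3.div h1 (by simpa using hx0)).mul h2).add (h1.mul (hU.hasDerivAt_fderiv_line v))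
    refine h4.congr_deriv ?_
    simp [hx]
    ring

/-- On the unit sphere, the Laplacian of `‖y‖ U(y)` for `U` homogeneous of degree zero. -/
theorem laplacian_norm_mul_of_homogeneous_zero [FiniteDimensional ℝ E] {U : E → ℝ} {x : E}
    (hx : ‖x‖ = 1) (hU : ContDiffAt ℝ 2 U x) (hom : ∀ c : ℝ, 0 < c → U (c • x) = U x) :
    (Δ (fun y => ‖y‖ * U y)) x = (Δ U) x + ((Module.finrank ℝ E : ℝ) - 1) * U x := by
  have hd : DifferentiableAt ℝ U x := hU.differentiableAt (by simp)
  set b := stdOrthonormalBasis ℝ E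
  simp only [InnerProductSpace.laplacian_eq_iteratedFDeriv_stdOrthonormalBasis,
    iteratedFDeriv_two_norm_mul hx hU, Finset.sum_add_distrib, ← Finset.mul_sum, ← Finset.sum_mul]
  -- The cross terms add up to the radial derivative, which Euler's identity kills.
  have h1 : ∑ i, ⟪x, b i⟫ * fderiv ℝ U x (b i) = 0 := by
    rw [← fderiv_apply_self_of_homogeneous_zero hom hd]
    have h := congrArg (fderiv ℝ U x) (b.sum_repr' x)
    simpa only [map_sum, map_smul, smul_eq_mul, real_inner_comm] using h
  have h2 : ∑ i, (‖b i‖ ^ 2 - ⟪x, b i⟫ ^ 2) = (Module.finrank ℝ E : ℝ) - 1 := by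
    have : ∑ i, ⟪x, b i⟫ ^ 2 = 1 := by
      have := b.sum_sq_norm_inner_left x
      simpa [hx] using this
    simp [this]
  rw [h1, h2]
  ring

/-- Second derivatives are homogeneous of degree `-1`, the degree in which `f` is extended; this
carries the Poisson equation from the sphere to all rays. -/
theorem iteratedFDeriv_two_smul_of_homogeneous_one {H : E → ℝ} {x : E} {c : ℝ} (hc : 0 < c)
    (hom : ∀ y, H (c • y) = c * H y) (hH : ContDiffAt ℝ 2 H x) (hH' : ContDiffAt ℝ 2 H (c • x))
    (v : E) :
    iteratedFDeriv ℝ 2 H (c • x) ![v, v] = c⁻¹ * iteratedFDeriv ℝ 2 H x ![v, v] := by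
  have hT : Tendsto (fun s : ℝ => c⁻¹ * s) (𝓝 0) (𝓝 0) := by
    have : Continuous fun s : ℝ => c⁻¹ * s := by fun_prop
    simpa using this.tendsto 0
  have hinner (s : ℝ) : HasDerivAt (fun s : ℝ => c⁻¹ * s) c⁻¹ s := by
    simpa using (hasDerivAt_id s).const_mul c⁻¹
  have heq (r : ℝ) : H (c • x + r • v) = c * H (x + (c⁻¹ * r) • v) := by
    rw [← hom, smul_add, smul_smul, mul_inv_cancel_left₀ hc.ne']
  refine hH'.iteratedFDeriv_two_eq_of_hasDerivAt
    (g := fun s => fderiv ℝ H (x + (c⁻¹ * s) • v) v) ?_ ?_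
  · filter_upwards [hT.eventually (hH.eventually_differentiableAt_line v)] with s hs
    have h := ((hasDerivAt_comp_line hs).comp s (hinner s)).const_mul c
    simp only [heq]
    refine h.congr_deriv ?_
    field_simp
  · have h := hH.hasDerivAt_fderiv_line v
    have h' : HasDerivAt (fun s : ℝ => fderiv ℝ H (x + s • v) v) (iteratedFDeriv ℝ 2 H x ![v, v])
      (c⁻¹ * 0) := by simpa using h
    exact (h'.comp (0 : ℝ) (hinner 0)).congr_deriv (mul_comm _ _)

theorem fderiv_smul_of_homogeneous_one {H : E → ℝ} {x : E} {c : ℝ} (hc : 0 < c)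
    (hom : ∀ y, H (c • y) = c * H y) : fderiv ℝ H (c • x) = fderiv ℝ H x := by
  have h := fderiv_comp_smul (𝕜 := ℝ) (f := H) c (x := x)
  have h2 : (fun y => H (c • y)) = fun y => c • H y := by funext y; simp [hom]
  rw [h2] at h
  have h3 : fderiv ℝ (fun y => c • H y) x = c • fderiv ℝ H x :=
    congrFun (fderiv_const_smul_field c (f := H)) x
  rw [h3] at h
  exact (smul_right_injective _ hc.ne' h).symm

/-- The second derivative of a function homogeneous of degree one only sees the component
orthogonal to the position. -/
theorem iteratedFDeriv_two_add_smul_self_of_homogeneous_one {H : E → ℝ} {x : E}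
    (hom : ∀ c : ℝ, 0 < c → ∀ y, H (c • y) = c * H y) (hH : ContDiffAt ℝ 2 H x) (v : E) (a : ℝ) :
    iteratedFDeriv ℝ 2 H x ![v + a • x, v + a • x] = iteratedFDeriv ℝ 2 H x ![v, v] := by
  have hd : DifferentiableAt ℝ (fderiv ℝ H) x :=
    (hH.fderiv_right (m := 1) (by norm_num)).differentiableAt (by simp)
  have h0 : fderiv ℝ (fderiv ℝ H) x x = 0 := fderiv_apply_self_of_homogeneous_zero
    (fun c hc => fderiv_smul_of_homogeneous_one hc (hom c hc)) hd
  have hs : fderiv ℝ (fderiv ℝ H) x v x = 0 := by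
    rw [(hH.isSymmSndFDerivAt (by simp)).eq v x, h0]; rfl
  simp [iteratedFDeriv_two_apply, h0, hs]

end InnerProduct

/-! ### The Laplacian: invariance under isometries and explicit values -/

section Laplacian

variable {E : Type*} [NormedAddCommGroup E] [InnerProductSpace ℝ E]

theorem iteratedFDeriv_two_comp_linearIsometryEquiv_add {H : E → ℝ} (σ : E ≃ₗᵢ[ℝ] E) {a x : E}
    (hH : ContDiffAt ℝ 2 H (σ x + a)) (v : E) :
    iteratedFDeriv ℝ 2 (fun y => H (σ y + a)) x ![v, v] =
      iteratedFDeriv ℝ 2 H (σ x + a) ![σ v, σ v] := by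
  have hc : ContDiffAt ℝ 2 (fun y => H (σ y + a)) x :=
    hH.comp x (σ.contDiff.contDiffAt.add contDiffAt_const)
  have he (r : ℝ) : H (σ (x + r • v) + a) = H (σ x + a + r • σ v) := by
    rw [map_add, map_smul, add_right_comm]
  refine hc.iteratedFDeriv_two_eq_of_hasDerivAt
    (g := fun s => fderiv ℝ H (σ x + a + s • σ v) (σ v)) ?_ (hH.hasDerivAt_fderiv_line _)
  filter_upwards [hH.eventually_differentiableAt_line (σ v)] with s hs
  simp only [he]
  exact hasDerivAt_comp_line hs

theorem contDiffAt_inner_div_norm (ξ : E) {x : E} (hx : x ≠ 0) :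
    ContDiffAt ℝ 2 (fun y : E => ⟪ξ, y⟫ / ‖y‖) x :=
  (contDiffAt_const.inner ℝ contDiffAt_id).div (contDiffAt_norm ℝ hx) (norm_ne_zero_iff.2 hx)

theorem inner_smul_div_norm_smul (ξ x : E) {c : ℝ} (hc : 0 < c) :
    ⟪ξ, c • x⟫ / ‖c • x‖ = ⟪ξ, x⟫ / ‖x‖ := by
  rw [real_inner_smul_right, norm_smul, Real.norm_of_nonneg hc.le, mul_div_mul_left _ _ hc.ne']

variable [FiniteDimensional ℝ E]

theorem laplacian_comp_linearIsometryEquiv_add {H : E → ℝ} (σ : E ≃ₗᵢ[ℝ] E) {a x : E}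
    (hH : ContDiffAt ℝ 2 H (σ x + a)) : (Δ (fun y => H (σ y + a))) x = (Δ H) (σ x + a) := by
  rw [InnerProductSpace.laplacian_eq_iteratedFDeriv_stdOrthonormalBasis,
    InnerProductSpace.laplacian_eq_iteratedFDeriv_orthonormalBasis H
      ((stdOrthonormalBasis ℝ E).map σ)]
  simp only [iteratedFDeriv_two_comp_linearIsometryEquiv_add σ hH, OrthonormalBasis.map_apply]

theorem laplacian_comp_add {H : E → ℝ} {a x : E}
    (hH : ContDiffAt ℝ 2 H (x + a)) : (Δ (fun y => H (y + a))) x = (Δ H) (x + a) :=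
  laplacian_comp_linearIsometryEquiv_add (LinearIsometryEquiv.refl ℝ E) hH

theorem laplacian_inner (ξ x : E) : (Δ (fun y : E => ⟪ξ, y⟫)) x = 0 := by
  have hc : ContDiffAt ℝ 2 (fun y : E => ⟪ξ, y⟫) x := contDiffAt_const.inner ℝ contDiffAt_id
  simp only [InnerProductSpace.laplacian_eq_iteratedFDeriv_stdOrthonormalBasis]
  refine Finset.sum_eq_zero fun i _ => ?_
  refine hc.iteratedFDeriv_two_eq_of_hasDerivAt (g := fun _ => ⟪ξ, stdOrthonormalBasis ℝ E i⟫)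
    (Eventually.of_forall fun s => ?_) (hasDerivAt_const _ _)
  simp only [inner_add_right, real_inner_smul_right]
  simpa using ((hasDerivAt_id s).mul_const ⟪ξ, stdOrthonormalBasis ℝ E i⟫).const_add ⟪ξ, x⟫

theorem laplacian_norm_sub_sq (p x : E) :
    (Δ (fun y : E => ‖y - p‖ ^ 2)) x = 2 * (Module.finrank ℝ E : ℝ) := by
  have hc : ContDiffAt ℝ 2 (fun y : E => ‖y - p‖ ^ 2) x := by
    have : ContDiff ℝ 2 (fun y : E => ‖y - p‖ ^ 2) := (contDiff_id.sub contDiff_const).norm_sq ℝ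
    exact this.contDiffAt
  have h (v : E) : iteratedFDeriv ℝ 2 (fun y : E => ‖y - p‖ ^ 2) x ![v, v] = 2 * ‖v‖ ^ 2 := by
    refine hc.iteratedFDeriv_two_eq_of_hasDerivAt (g := fun s => 2 * (⟪x - p, v⟫ + s * ‖v‖ ^ 2))
      (Eventually.of_forall fun s => ?_) ?_
    · have h1 : HasDerivAt (fun r : ℝ => x + r • v - p) v s := by
        simpa using (((hasDerivAt_id s).smul_const v).const_add x).sub_const p
      refine h1.norm_sq.congr_deriv ?_
      rw [add_sub_right_comm, inner_add_left, real_inner_smul_left, real_inner_self_eq_norm_sq]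
    · simpa using (((hasDerivAt_id (0 : ℝ)).mul_const (‖v‖ ^ 2)).const_add ⟪x - p, v⟫).const_mul 2
  simp [InnerProductSpace.laplacian_eq_iteratedFDeriv_stdOrthonormalBasis, h, mul_comm]

theorem ContDiffAt.continuousAt_laplacian {H : E → ℝ} {x : E} (hH : ContDiffAt ℝ 2 H x) :
    ContinuousAt (Δ H) x := by
  have h1 : ContinuousAt (fderiv ℝ (fderiv ℝ H)) x :=
    ((hH.fderiv_right (m := 1) (by norm_num)).fderiv_right (m := 0) (by norm_num)).continuousAt
  simp only [InnerProductSpace.laplacian_eq_iteratedFDeriv_stdOrthonormalBasis,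
    iteratedFDeriv_two_apply]
  exact tendsto_finsetSum _ fun i _ =>
    (h1.clm_apply continuousAt_const).clm_apply continuousAt_const

/-- The norm times this function is linear, hence harmonic. The value is strictly negative on the
open hemisphere in dimension at least two, which makes the function a barrier for the minimum
principle. -/
theorem laplacian_inner_div_norm (ξ : E) {x : E} (hx : ‖x‖ = 1) :
    (Δ (fun y : E => ⟪ξ, y⟫ / ‖y‖)) x = -((Module.finrank ℝ E : ℝ) - 1) * ⟪ξ, x⟫ := by
  have hx0 : x ≠ 0 := by rintro rfl; simp at hx
  have h := laplacian_norm_mul_of_homogeneous_zero hx (contDiffAt_inner_div_norm ξ hx0)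
    fun c hc => inner_smul_div_norm_smul ξ x hc
  have he : (fun y : E => ‖y‖ * (⟪ξ, y⟫ / ‖y‖)) = fun y : E => ⟪ξ, y⟫ := by
    funext y
    rcases eq_or_ne y 0 with rfl | hy
    · simp
    · field_simp [norm_ne_zero_iff.2 hy]
  rw [he, laplacian_inner, hx, div_one] at h
  linarith

end Laplacian

/-- Symmetric difference quotients of a `C¹` function converge uniformly on compact sets. -/
theorem IsCompact.eventually_abs_symmetric_difference_le {E : Type*} [NormedAddCommGroup E]
    [NormedSpace ℝ E] {K : Set E} (hK : IsCompact K) {H : E → ℝ}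
    (hH : ∀ y ∈ K, ContDiffAt ℝ 1 H y) (ξ : E) {η : ℝ} (hη : 0 < η) :
    ∀ᶠ h : ℝ in 𝓝[>] 0, ∀ y ∈ K,
      |H (y + h • ξ) - H (y - h • ξ) - 2 * h * fderiv ℝ H y ξ| ≤ 2 * h * η := by
  have key : ∀ᶠ s : ℝ in 𝓝 0, ∀ y ∈ K, DifferentiableAt ℝ H (y + s • ξ) ∧
      |fderiv ℝ H (y + s • ξ) ξ - fderiv ℝ H y ξ| ≤ η := by
    refine hK.eventually_forall_of_forall_eventually fun y hy => ?_
    have hc : Tendsto (fun z : ℝ × E => z.2 + z.1 • ξ) (𝓝 (0, y)) (𝓝 y) := by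
      have : Continuous fun z : ℝ × E => z.2 + z.1 • ξ := by fun_prop
      simpa using this.tendsto (0, y)
    have hf : ContinuousAt (fun z => fderiv ℝ H z ξ) y :=
      ((hH y hy).fderiv_right (m := 0) (by norm_num)).continuousAt.clm_apply continuousAt_const
    have h1 : Tendsto (fun z : ℝ × E => |fderiv ℝ H (z.2 + z.1 • ξ) ξ - fderiv ℝ H z.2 ξ|)
        (𝓝 (0, y)) (𝓝 0) := by
      have := ((hf.tendsto.comp hc).sub (hf.tendsto.comp (continuous_snd.tendsto (0, y)))).abs
      simpa using this
    refine Eventually.and ?_ ((h1.eventually (gt_mem_nhds hη)).mono fun z hz => hz.le)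
    exact hc.eventually (((hH y hy).eventually (by simp)).mono fun z hz =>
      hz.differentiableAt (by simp))
  obtain ⟨δ, hδ, hkey⟩ := Metric.eventually_nhds_iff.1 key
  filter_upwards [self_mem_nhdsWithin, nhdsWithin_le_nhds (gt_mem_nhds hδ)] with h (hh : 0 < h) hhδ
  intro y hy
  -- Mean value inequality on `[-h, h]` after subtracting the linear part: the remaining derivative
  -- is at most `η` in absolute value.
  have hder : ∀ s ∈ Set.Icc (-h) h, HasDerivWithinAt
      (fun s : ℝ => H (y + s • ξ) - s * fderiv ℝ H y ξ)
      (fderiv ℝ H (y + s • ξ) ξ - fderiv ℝ H y ξ) (Set.Icc (-h) h) s := by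
    intro s hs
    have hs' : dist s 0 < δ := by
      rw [Real.dist_eq, sub_zero, abs_lt]
      constructor <;> linarith [hs.1, hs.2]
    have := (hasDerivAt_comp_line (hkey hs' y hy).1).sub
      ((hasDerivAt_id s).mul_const (fderiv ℝ H y ξ))
    exact (this.congr_deriv (by simp)).hasDerivWithinAt
  have hbound : ∀ s ∈ Set.Icc (-h) h, ‖fderiv ℝ H (y + s • ξ) ξ - fderiv ℝ H y ξ‖ ≤ η := by
    intro s hs
    have hs' : dist s 0 < δ := by
      rw [Real.dist_eq, sub_zero, abs_lt]
      constructor <;> linarith [hs.1, hs.2]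
    exact (hkey hs' y hy).2
  have := (convex_Icc (-h) h).norm_image_sub_le_of_norm_hasDerivWithin_le hder hbound
    (x := -h) (y := h) ⟨le_rfl, by linarith⟩ ⟨by linarith, le_rfl⟩
  simp only [Real.norm_eq_abs] at this
  rw [abs_of_pos (show 0 < h - -h by linarith)] at this
  calc _ = |H (y + h • ξ) - h * fderiv ℝ H y ξ - (H (y + -h • ξ) - -h * fderiv ℝ H y ξ)| := by
        rw [neg_smul, ← sub_eq_add_neg]; ring_nf
    _ ≤ _ := this
    _ = _ := by ring

/-! ### The minimum principle on the half-space -/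

section HalfSpace

variable {E : Type*} [NormedAddCommGroup E] [InnerProductSpace ℝ E] [FiniteDimensional ℝ E]

/-- Let `H` be homogeneous of degree one and `C²` off the origin. If the part of `Δ H` that is even
under the reflection `σ` in the hyperplane `ξᗮ` decreases away from the hyperplane, then the
derivative in direction `ξ` of the even part of `H` is nonnegative on the half-space. This is a
minimum principle for the function `w = ∂_ξ H - (∂_ξ H) ∘ σ`, which is homogeneous of degree zero,
vanishes on the hyperplane, and is superharmonic in the sense of difference quotients. -/
theorem fderiv_le_fderiv_of_reflection_antitone (hdim : 2 ≤ Module.finrank ℝ E) {H : E → ℝ}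
    (hom : ∀ c : ℝ, 0 < c → ∀ y, H (c • y) = c * H y)
    (hH : ∀ y, y ≠ 0 → ContDiffAt ℝ 2 H y) {ξ : E} (hξ : ‖ξ‖ = 1)
    (hF : ∀ x : E, ⟪ξ, x⟫ = 0 → ∀ s t : ℝ, 0 < s → s ≤ t →
      (Δ H) (x + t • ξ) + (Δ H) (x - t • ξ) ≤ (Δ H) (x + s • ξ) + (Δ H) (x - s • ξ))
    {x : E} (hx : ⟪ξ, x⟫ = 0) {t : ℝ} (ht : 0 < t) :
    fderiv ℝ H (x - t • ξ) ξ ≤ fderiv ℝ H (x + t • ξ) ξ := by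
  by_contra! hlt
  have hξξ : ⟪ξ, ξ⟫ = 1 := by rw [real_inner_self_eq_norm_sq, hξ, one_pow]
  obtain ⟨σ, hσ⟩ : ∃ σ : E ≃ₗᵢ[ℝ] E, ∀ y, σ y = y - (2 * ⟪ξ, y⟫) • ξ := by
    refine ⟨(ℝ ∙ ξ)ᗮ.reflection, fun y => ?_⟩
    rw [Submodule.reflection_orthogonal_apply, Submodule.reflection_singleton_apply]
    simp only [hξ, one_pow, div_one, RCLike.ofReal_one, neg_sub]
    module
  have hσin (y : E) : ⟪ξ, σ y⟫ = -⟪ξ, y⟫ := by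
    rw [hσ, inner_sub_right, real_inner_smul_right, hξξ]; ring
  have hσ0 {y : E} (hy : y ≠ 0) : σ y ≠ 0 := by simpa using hy
  have hne {y : E} (hy : ⟪ξ, y⟫ ≠ 0) : y ≠ 0 := by rintro rfl; simp at hy
  set w : E → ℝ := fun y => fderiv ℝ H y ξ - fderiv ℝ H (σ y) ξ with hw
  set β : E → ℝ := fun y => ⟪ξ, y⟫ / ‖y‖ with hβ
  have hfd (y : E) (hy : y ≠ 0) : ContinuousAt (fun y => fderiv ℝ H y ξ) y :=
    ((hH y hy).fderiv_right (m := 1) (by norm_num)).continuousAt.clm_apply continuousAt_const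
  have hwc (y : E) (hy : y ≠ 0) : ContinuousAt w y :=
    (hfd y hy).sub ((hfd (σ y) (hσ0 hy)).comp (f := σ) σ.continuous.continuousAt)
  have hwhom (c : ℝ) (hc : 0 < c) (y : E) : w (c • y) = w y := by
    simp only [hw, map_smul, fderiv_smul_of_homogeneous_one hc (hom c hc)]
  have hβhom (c : ℝ) (hc : 0 < c) (y : E) : β (c • y) = β y := inner_smul_div_norm_smul ξ y hc
  set y₀ : E := x + t • ξ with hy₀
  have hy₀in : ⟪ξ, y₀⟫ = t := by rw [hy₀, inner_add_right, real_inner_smul_right, hx, hξξ]; ring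
  have hy₀0 : y₀ ≠ 0 := hne (by rw [hy₀in]; exact ht.ne')
  have hwy₀ : w y₀ < 0 := by
    have : σ y₀ = x - t • ξ := by rw [hσ, hy₀in, hy₀]; module
    simp only [hw, this]
    linarith
  -- Since `β ≤ 1`, adding `ε β` leaves the value at `y₀` negative.
  obtain ⟨ε, hε, hεw⟩ : ∃ ε : ℝ, 0 < ε ∧ w y₀ + ε < 0 := ⟨-w y₀ / 2, by linarith, by linarith⟩
  have hβ1 (y : E) : β y ≤ 1 := by
    refine div_le_one_of_le₀ ((real_inner_le_norm ξ y).trans ?_) (norm_nonneg _)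
    rw [hξ, one_mul]
  set K : Set E := sphere 0 1 ∩ {y | 0 ≤ ⟪ξ, y⟫} with hK
  have hKc : IsCompact K := (isCompact_sphere 0 1).inter_right
    (isClosed_le continuous_const (continuous_const.inner continuous_id))
  have hnormalize {y : E} (hy : y ≠ 0) (hy' : 0 ≤ ⟪ξ, y⟫) : ‖y‖⁻¹ • y ∈ K := by
    refine ⟨by simp [norm_smul, hy], ?_⟩
    simp only [Set.mem_ofPred_eq, real_inner_smul_right]
    positivity
  set G : E → ℝ := fun y => w y + ε * β y with hG
  have hGhom {y : E} (hy : y ≠ 0) : G (‖y‖⁻¹ • y) = G y := by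
    have : 0 < ‖y‖⁻¹ := by positivity
    simp only [hG, hwhom _ this, hβhom _ this]
  have hK0 {y : E} (hy : y ∈ K) : y ≠ 0 := by
    rintro rfl
    simpa using hy.1
  have hGc : ContinuousOn G K := fun y hy =>
    ((hwc y (hK0 hy)).add (continuousAt_const.mul
      (contDiffAt_inner_div_norm ξ (hK0 hy)).continuousAt)).continuousWithinAt
  -- Degree-zero homogeneity replaces the noncompact half-space by a compact hemisphere; the minimum
  -- there is a minimum over the whole closed half-space minus the origin.
  obtain ⟨p, hpK, hpmin⟩ := hKc.exists_isMinOn ⟨_, hnormalize hy₀0 (hy₀in ▸ ht.le)⟩ hGc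
  have hGmin {y : E} (hy : y ≠ 0) (hy' : 0 ≤ ⟪ξ, y⟫) : G p ≤ G y := by
    rw [← hGhom hy]
    exact hpmin (hnormalize hy hy')
  have hGp : G p < 0 := by
    refine (hGmin hy₀0 (hy₀in ▸ ht.le)).trans_lt ?_
    have : ε * β y₀ ≤ ε * 1 := by gcongr; exact hβ1 _
    simp only [hG]
    linarith
  have hp1 : ‖p‖ = 1 := by simpa using hpK.1
  have hp0 : p ≠ 0 := hK0 hpK
  -- On the equator both `w` and `β` vanish, so the negative minimum lies in the open hemisphere.
  obtain ⟨a, ha, hpa⟩ : ∃ a : ℝ, 0 < a ∧ ⟪ξ, p⟫ = a := by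
    refine ⟨_, lt_of_le_of_ne hpK.2 fun h => hGp.ne ?_, rfl⟩
    have : σ p = p := by rw [hσ, ← h]; simp
    simp [hG, hw, hβ, this, ← h]
  set N : ℝ := (Module.finrank ℝ E : ℝ) with hN
  have hN2 : 2 ≤ N := by rw [hN]; exact_mod_cast hdim
  have hβp : (Δ β) p < -(a / 2) := by
    have : (Δ β) p = -(N - 1) * ⟪ξ, p⟫ := laplacian_inner_div_norm ξ hp1
    rw [this, hpa]
    nlinarith
  have hev : ∀ᶠ y in 𝓝 p, (Δ β) y < -(a / 2) ∧ a / 2 < ⟪ξ, y⟫ := by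
    refine ((contDiffAt_inner_div_norm ξ hp0).continuousAt_laplacian.eventually
      (gt_mem_nhds hβp)).and ?_
    have : Continuous fun y : E => ⟪ξ, y⟫ := continuous_const.inner continuous_id
    exact this.continuousAt.eventually (lt_mem_nhds (by change _ < ⟪ξ, p⟫; linarith))
  obtain ⟨r, hr, hrB⟩ := nhds_basis_closedBall.eventually_iff.1 hev
  -- The term `κ ‖y - p‖²` makes the minimum strict, and its Laplacian `2 κ N` stays below the gain
  -- `ε a / 2` from the barrier.
  obtain ⟨κ, hκ, hκN⟩ : ∃ κ : ℝ, 0 < κ ∧ κ * (2 * N) < ε * (a / 2) := by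
    refine ⟨ε * a / (8 * N), by positivity, ?_⟩
    have : ε * a / (8 * N) * (2 * N) = ε * a / 4 := by field_simp; norm_num
    rw [this]
    nlinarith [mul_pos hε ha]
  have hB0 {y : E} (hy : y ∈ closedBall p r) : y ≠ 0 :=
    hne (by have := (hrB hy).2; linarith)
  have hB : IsCompact (closedBall p r) := isCompact_closedBall p r
  -- Two difference quotients, each with error `κ r² / 8`, approximate `w` within `κ r² / 4`.
  have hη : 0 < κ * r ^ 2 / 8 := by positivity
  have hq1 := hB.eventually_abs_symmetric_difference_le
    (fun y hy => (hH y (hB0 hy)).of_le (by norm_num)) ξ hη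
  have hq2 := (hB.image σ.continuous).eventually_abs_symmetric_difference_le (H := H)
    (by
      rintro _ ⟨y, hy, rfl⟩
      exact (hH _ (hσ0 (hB0 hy))).of_le (by norm_num)) ξ hη
  -- With `h < a / 2` the shifts by `± h ξ` of the ball and of its mirror image do not meet the
  -- hyperplane, so `H` is `C²` at all these points.
  obtain ⟨h, ⟨⟨hh1, hh2⟩, (hhpos : 0 < h)⟩, hha⟩ := (((hq1.and hq2).and self_mem_nhdsWithin).and
    (nhdsWithin_le_nhds (gt_mem_nhds (show (0 : ℝ) < a / 2 by positivity)))).exists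
  set ψ : E → ℝ := (fun y => H (y + h • ξ)) - (fun y => H (y + -(h • ξ))) -
    ((fun y => H (σ y + h • ξ)) - (fun y => H (σ y + -(h • ξ)))) with hψ
  have hψw {y : E} (hy : y ∈ closedBall p r) : |(2 * h)⁻¹ * ψ y - w y| ≤ κ * r ^ 2 / 4 := by
    have e1 := abs_le.1 (hh1 y hy)
    have e2 := abs_le.1 (hh2 (σ y) ⟨y, hy, rfl⟩)
    have e3 : ψ y - 2 * h * w y = (H (y + h • ξ) - H (y - h • ξ) - 2 * h * fderiv ℝ H y ξ) -
        (H (σ y + h • ξ) - H (σ y - h • ξ) - 2 * h * fderiv ℝ H (σ y) ξ) := by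
      simp only [hψ, hw, Pi.sub_apply, ← sub_eq_add_neg]; ring
    have e4 : (2 * h)⁻¹ * ψ y - w y = (2 * h)⁻¹ * (ψ y - 2 * h * w y) := by
      field_simp
    rw [e4, abs_mul, abs_of_pos (by positivity : 0 < (2 * h)⁻¹), inv_mul_le_iff₀ (by positivity),
      abs_le]
    constructor <;> linarith
  set Φ : E → ℝ := (2 * h)⁻¹ • ψ + ε • β + κ • fun y => ‖y - p‖ ^ 2 with hΦ
  have hΦv (y : E) : Φ y = (2 * h)⁻¹ * ψ y + ε * β y + κ * ‖y - p‖ ^ 2 := rfl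
  have hin {y : E} (c : ℝ) : ⟪ξ, y + c • ξ⟫ = ⟪ξ, y⟫ + c := by
    rw [inner_add_right, real_inner_smul_right, hξξ, mul_one]
  have d1 {y : E} (hy : y ∈ closedBall p r) : ContDiffAt ℝ 2 H (y + h • ξ) :=
    hH _ (hne (by rw [hin]; linarith [(hrB hy).2]))
  have d2 {y : E} (hy : y ∈ closedBall p r) : ContDiffAt ℝ 2 H (y + -(h • ξ)) :=
    hH _ (hne (by rw [← neg_smul, hin]; linarith [(hrB hy).2]))
  have d3 {y : E} (hy : y ∈ closedBall p r) : ContDiffAt ℝ 2 H (σ y + h • ξ) :=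
    hH _ (hne (by rw [hin, hσin]; linarith [(hrB hy).2]))
  have d4 {y : E} (hy : y ∈ closedBall p r) : ContDiffAt ℝ 2 H (σ y + -(h • ξ)) :=
    hH _ (hne (by rw [← neg_smul, hin, hσin]; linarith [(hrB hy).2]))
  have c1 {y : E} (hy : y ∈ closedBall p r) : ContDiffAt ℝ 2 (fun y => H (y + h • ξ)) y :=
    (d1 hy).comp y (contDiffAt_id.add contDiffAt_const)
  have c2 {y : E} (hy : y ∈ closedBall p r) : ContDiffAt ℝ 2 (fun y => H (y + -(h • ξ))) y :=
    (d2 hy).comp y (contDiffAt_id.add contDiffAt_const)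
  have c3 {y : E} (hy : y ∈ closedBall p r) : ContDiffAt ℝ 2 (fun y => H (σ y + h • ξ)) y :=
    (d3 hy).comp y (σ.contDiff.contDiffAt.add contDiffAt_const)
  have c4 {y : E} (hy : y ∈ closedBall p r) : ContDiffAt ℝ 2 (fun y => H (σ y + -(h • ξ))) y :=
    (d4 hy).comp y (σ.contDiff.contDiffAt.add contDiffAt_const)
  have c12 {y : E} (hy : y ∈ closedBall p r) :
      ContDiffAt ℝ 2 ((fun y => H (y + h • ξ)) - (fun y => H (y + -(h • ξ)))) y :=
    (c1 hy).sub (c2 hy)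
  have c34 {y : E} (hy : y ∈ closedBall p r) :
      ContDiffAt ℝ 2 ((fun y => H (σ y + h • ξ)) - (fun y => H (σ y + -(h • ξ)))) y :=
    (c3 hy).sub (c4 hy)
  have cψ {y : E} (hy : y ∈ closedBall p r) : ContDiffAt ℝ 2 ψ y := (c12 hy).sub (c34 hy)
  have cβ {y : E} (hy : y ∈ closedBall p r) : ContDiffAt ℝ 2 β y :=
    contDiffAt_inner_div_norm ξ (hB0 hy)
  have cn (y : E) : ContDiffAt ℝ 2 (fun y => ‖y - p‖ ^ 2) y :=
    ((contDiff_id.sub contDiff_const).norm_sq ℝ).contDiffAt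
  have sψ {y : E} (hy : y ∈ closedBall p r) : ContDiffAt ℝ 2 ((2 * h)⁻¹ • ψ) y :=
    (cψ hy).const_smul (2 * h)⁻¹
  have sβ {y : E} (hy : y ∈ closedBall p r) : ContDiffAt ℝ 2 (ε • β) y := (cβ hy).const_smul ε
  have sn (y : E) : ContDiffAt ℝ 2 (κ • fun y => ‖y - p‖ ^ 2) y := (cn y).const_smul κ
  have sψβ {y : E} (hy : y ∈ closedBall p r) : ContDiffAt ℝ 2 ((2 * h)⁻¹ • ψ + ε • β) y :=
    (sψ hy).add (sβ hy)
  have cΦ {y : E} (hy : y ∈ closedBall p r) : ContDiffAt ℝ 2 Φ y := (sψβ hy).add (sn y)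
  -- On the sphere `Φ ≥ G p + 3 κ r² / 4`, while `Φ p ≤ G p + κ r² / 4`.
  obtain ⟨q, hq, hqmin⟩ : ∃ z ∈ ball p r, IsLocalMin Φ z := by
    refine Metric.exists_isLocalMin_mem_ball
      (fun y hy => (cΦ hy).continuousAt.continuousWithinAt) (mem_closedBall_self hr.le) ?_
    intro z hz
    have hzB := sphere_subset_closedBall hz
    have hzr : ‖z - p‖ = r := by simpa [dist_eq_norm] using hz
    have e1 := abs_le.1 (hψw (mem_closedBall_self (x := p) hr.le))
    have e2 := abs_le.1 (hψw hzB)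
    have e3 := hGmin (hB0 hzB) (by linarith [(hrB hzB).2])
    have e4 : 0 < κ * r ^ 2 := by positivity
    simp only [hG] at e3
    rw [hΦv, hΦv, hzr, sub_self, norm_zero]
    nlinarith
  have hqB := ball_subset_closedBall hq
  -- The four points where `Δ H` is evaluated are two mirror pairs, at heights `⟪ξ, q⟫ ± h` over the
  -- same foot point, so `hF` compares them.
  have hΔψ : (Δ ψ) q ≤ 0 := by
    rw [hψ, (c12 hqB).laplacian_sub (c34 hqB),
      (c1 hqB).laplacian_sub (c2 hqB), (c3 hqB).laplacian_sub (c4 hqB),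
      laplacian_comp_add (d1 hqB), laplacian_comp_add (d2 hqB),
      laplacian_comp_linearIsometryEquiv_add σ (d3 hqB),
      laplacian_comp_linearIsometryEquiv_add σ (d4 hqB)]
    have hqa := (hrB hqB).2
    have hperp : ⟪ξ, q - ⟪ξ, q⟫ • ξ⟫ = 0 := by
      rw [inner_sub_right, real_inner_smul_right, hξξ]; ring
    have := hF (q - ⟪ξ, q⟫ • ξ) hperp (⟪ξ, q⟫ - h) (⟪ξ, q⟫ + h) (by linarith) (by linarith)
    have e1 : q - ⟪ξ, q⟫ • ξ + (⟪ξ, q⟫ + h) • ξ = q + h • ξ := by module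
    have e2 : q - ⟪ξ, q⟫ • ξ + (⟪ξ, q⟫ - h) • ξ = q + -(h • ξ) := by module
    have e3 : q - ⟪ξ, q⟫ • ξ - (⟪ξ, q⟫ + h) • ξ = σ q + -(h • ξ) := by rw [hσ]; module
    have e4 : q - ⟪ξ, q⟫ • ξ - (⟪ξ, q⟫ - h) • ξ = σ q + h • ξ := by rw [hσ]; module
    rw [e1, e2, e3, e4] at this
    linarith
  have hpos := hqmin.laplacian_nonneg (cΦ hqB)
  rw [hΦ, (sψβ hqB).laplacian_add (sn q), (sψ hqB).laplacian_add (sβ hqB),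
    InnerProductSpace.laplacian_smul _ (cψ hqB), InnerProductSpace.laplacian_smul _ (cβ hqB),
    InnerProductSpace.laplacian_smul _ (cn q), laplacian_norm_sub_sq] at hpos
  simp only [smul_eq_mul] at hpos
  -- Hence `Δ Φ(q) < -ε a / 2 + 2 κ N < 0`, impossible at a local minimum.
  have e1 : (2 * h)⁻¹ * (Δ ψ) q ≤ 0 := mul_nonpos_of_nonneg_of_nonpos (by positivity) hΔψ
  have e2 : ε * (Δ β) q < ε * -(a / 2) := by gcongr; exact (hrB hqB).1
  linarith

/-- Under the hypotheses of `fderiv_le_fderiv_of_reflection_antitone`, the second derivative of `H`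
in the direction `ξ` is nonnegative at the points of the hyperplane `ξᗮ`. -/
theorem iteratedFDeriv_two_nonneg_of_reflection_antitone (hdim : 2 ≤ Module.finrank ℝ E)
    {H : E → ℝ} (hom : ∀ c : ℝ, 0 < c → ∀ y, H (c • y) = c * H y)
    (hH : ∀ y, y ≠ 0 → ContDiffAt ℝ 2 H y) {ξ : E} (hξ : ‖ξ‖ = 1)
    (hF : ∀ x : E, ⟪ξ, x⟫ = 0 → ∀ s t : ℝ, 0 < s → s ≤ t →
      (Δ H) (x + t • ξ) + (Δ H) (x - t • ξ) ≤ (Δ H) (x + s • ξ) + (Δ H) (x - s • ξ))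
    {x : E} (hx0 : x ≠ 0) (hx : ⟪ξ, x⟫ = 0) : 0 ≤ iteratedFDeriv ℝ 2 H x ![ξ, ξ] := by
  have h1 := (hH x hx0).hasDerivAt_fderiv_line ξ
  have h1' : HasDerivAt (fun s : ℝ => fderiv ℝ H (x + s • ξ) ξ)
    (iteratedFDeriv ℝ 2 H x ![ξ, ξ]) (-0) := by simpa using h1
  -- The function `s ↦ ∂_ξ H(x + sξ) - ∂_ξ H(x - sξ)` vanishes at `0` and is nonnegative for `s >
  -- 0`; its derivative at `0` is twice the second derivative sought.
  have h2 := h1.sub (h1'.comp (0 : ℝ) (hasDerivAt_neg 0))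
  have h3 := h2.tendsto_slope_zero_right
  have h4 : 0 ≤ iteratedFDeriv ℝ 2 H x ![ξ, ξ] - iteratedFDeriv ℝ 2 H x ![ξ, ξ] * -1 := by
    refine ge_of_tendsto h3 ?_
    filter_upwards [self_mem_nhdsWithin] with t (ht : 0 < t)
    have := fderiv_le_fderiv_of_reflection_antitone hdim hom hH hξ hF hx ht
    simp only [zero_add, Pi.sub_apply, Function.comp_apply, neg_zero, sub_self, sub_zero,
      smul_eq_mul, neg_smul, ← sub_eq_add_neg]
    exact mul_nonneg (by positivity) (by linarith)
  linarith

end HalfSpace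

/-! ### Regularity of homogeneous extensions -/

section HomogeneousExtension

variable {n : ℕ}

theorem homExt_of_ne_zero (k : ℤ) (g : Sph n → ℝ) {x : Euc n} (hx : x ≠ 0) :
    homExt k g x = ‖x‖ ^ k * g ⟨‖x‖⁻¹ • x, inv_norm_smul_mem_unitSphere hx⟩ := by
  simp [homExt, hx]

theorem homExt_apply_zero (k : ℤ) (g : Sph n → ℝ) : homExt k g 0 = 0 := by
  simp [homExt]

theorem homExt_coe (k : ℤ) (g : Sph n → ℝ) (x : Sph n) : homExt k g (x : Euc n) = g x := by
  have hx : ‖(x : Euc n)‖ = 1 := by simp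
  have hx0 : (x : Euc n) ≠ 0 := by
    intro h
    simp [h] at hx
  have h1 : (⟨‖(x : Euc n)‖⁻¹ • (x : Euc n), inv_norm_smul_mem_unitSphere hx0⟩ : Sph n) = x := by
    ext1
    simp
  rw [homExt_of_ne_zero k g hx0, h1, hx, one_zpow, one_mul]

theorem homExt_eq_norm_zpow_mul (k : ℤ) (g : Sph n → ℝ) (x : Euc n) :
    homExt k g x = ‖x‖ ^ k * homExt 0 g x := by
  rcases eq_or_ne x 0 with rfl | hx
  · simp [homExt_apply_zero]
  · simp [homExt_of_ne_zero _ g hx]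

theorem homExt_one_eq_norm_mul (u : Sph n → ℝ) : homExt 1 u = fun y => ‖y‖ * homExt 0 u y := by
  funext y
  rw [homExt_eq_norm_zpow_mul, zpow_one]

theorem homExt_smul (k : ℤ) (g : Sph n → ℝ) {c : ℝ} (hc : 0 < c) (x : Euc n) :
    homExt k g (c • x) = c ^ k * homExt k g x := by
  rcases eq_or_ne x 0 with rfl | hx
  · simp [homExt_apply_zero]
  · have h1 : (⟨‖c • x‖⁻¹ • c • x, inv_norm_smul_mem_unitSphere (smul_ne_zero hc.ne' hx)⟩ : Sph n) =
        ⟨‖x‖⁻¹ • x, inv_norm_smul_mem_unitSphere hx⟩ := by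
      ext1
      simp only [smul_smul, norm_smul, Real.norm_of_nonneg hc.le]
      congr 1
      field_simp
    rw [homExt_of_ne_zero k g hx, homExt_of_ne_zero k g (smul_ne_zero hc.ne' hx), h1, norm_smul,
      Real.norm_of_nonneg hc.le, mul_zpow, mul_assoc]

theorem homExt_pos (k : ℤ) {g : Sph n → ℝ} (hg : ∀ x, 0 < g x) {x : Euc n} (hx : x ≠ 0) :
    0 < homExt k g x := by
  rw [homExt_of_ne_zero k g hx]
  exact mul_pos (zpow_pos (norm_pos_iff.2 hx) k) (hg _)

theorem ContMDiff.contDiffAt_homExt_zero {u : Sph n → ℝ} {m : WithTop ℕ∞}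
    (hu : ContMDiff (𝓡 n) 𝓘(ℝ, ℝ) m u) {x : Euc n} (hx : x ≠ 0) :
    ContDiffAt ℝ m (homExt 0 u) x := by
  let U : TopologicalSpace.Opens (Euc n) := ⟨{0}ᶜ, isOpen_compl_singleton⟩
  have hU (y : U) : (y : Euc n) ≠ 0 := y.2
  have h1 : ContMDiff 𝓘(ℝ, Euc n) 𝓘(ℝ, Euc n) m (fun y : U => ‖(y : Euc n)‖⁻¹ • (y : Euc n)) := by
    intro y
    have : ContDiffAt ℝ m (fun z : Euc n => ‖z‖⁻¹ • z) y :=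
      ((contDiffAt_norm ℝ (hU y)).inv (norm_ne_zero_iff.2 (hU y))).smul contDiffAt_id
    exact contMDiffAt_subtype_iff.2 this.contMDiffAt
  have h2 := hu.comp (h1.codRestrict_sphere fun y => inv_norm_smul_mem_unitSphere (hU y))
  have h3 : ContMDiff 𝓘(ℝ, Euc n) 𝓘(ℝ, ℝ) m (fun y : U => homExt 0 u y) := by
    refine h2.congr fun y => ?_
    rw [homExt_of_ne_zero 0 u (hU y), zpow_zero, one_mul]
    rfl
  exact (contMDiffAt_subtype_iff.1 (h3 ⟨x, hx⟩)).contDiffAt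

theorem ContMDiff.contDiffAt_homExt_one {u : Sph n → ℝ} {m : WithTop ℕ∞}
    (hu : ContMDiff (𝓡 n) 𝓘(ℝ, ℝ) m u) {x : Euc n} (hx : x ≠ 0) :
    ContDiffAt ℝ m (homExt 1 u) x := by
  rw [homExt_one_eq_norm_mul]
  exact (contDiffAt_norm ℝ hx).mul (hu.contDiffAt_homExt_zero hx)

theorem norm_inv_norm_smul_sub_le {E : Type*} [NormedAddCommGroup E] [NormedSpace ℝ E] {y z : E}
    {δ : ℝ} (hδ : 0 < δ) (hy : δ ≤ ‖y‖) (hz : δ ≤ ‖z‖) :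
    ‖‖y‖⁻¹ • y - ‖z‖⁻¹ • z‖ ≤ 2 / δ * ‖y - z‖ := by
  have hy0 : 0 < ‖y‖ := hδ.trans_le hy
  have hz0 : 0 < ‖z‖ := hδ.trans_le hz
  have e : ‖y‖⁻¹ • y - ‖z‖⁻¹ • z = ‖y‖⁻¹ • (y - z) + ((‖z‖ - ‖y‖) * (‖y‖⁻¹ * ‖z‖⁻¹)) • z := by
    have : (‖z‖ - ‖y‖) * (‖y‖⁻¹ * ‖z‖⁻¹) = ‖y‖⁻¹ - ‖z‖⁻¹ := by field_simp
    rw [this]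
    module
  have h1 : |‖z‖ - ‖y‖| ≤ ‖y - z‖ := by
    rw [norm_sub_rev]
    exact abs_norm_sub_norm_le z y
  have h2 : ‖y‖⁻¹ ≤ δ⁻¹ := inv_anti₀ hδ hy
  calc _ ≤ ‖y‖⁻¹ * ‖y - z‖ + |‖z‖ - ‖y‖| * (‖y‖⁻¹ * ‖z‖⁻¹) * ‖z‖ := by
        rw [e]
        refine (norm_add_le _ _).trans_eq ?_
        rw [norm_smul, norm_smul, norm_mul, norm_mul, norm_inv, norm_inv, norm_norm, norm_norm,
          Real.norm_eq_abs]
    _ = ‖y‖⁻¹ * ‖y - z‖ + ‖y‖⁻¹ * |‖z‖ - ‖y‖| := by field_simp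
    _ ≤ δ⁻¹ * ‖y - z‖ + δ⁻¹ * ‖y - z‖ := by gcongr
    _ = _ := by ring

/-- Off a ball around the origin, `‖y‖⁻¹` and the radial projection are Lipschitz, and `f` is
bounded by compactness. -/
theorem LipschitzWith.exists_lipschitzOnWith_homExt_neg_one {f : Sph n → ℝ} {K : NNReal}
    (hf : LipschitzWith K f) {δ : ℝ} (hδ : 0 < δ) :
    ∃ C : NNReal, LipschitzOnWith C (homExt (-1) f) {y | δ ≤ ‖y‖} := by
  obtain ⟨M, hM⟩ := isCompact_univ.exists_bound_of_continuousOn hf.continuous.continuousOn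
  have hM0 : 0 ≤ max M 0 := le_max_right _ _
  refine ⟨Real.toNNReal (δ⁻¹ * (K * (2 / δ)) + δ⁻¹ * δ⁻¹ * max M 0),
    LipschitzOnWith.of_dist_le_mul fun y (hy : δ ≤ ‖y‖) z (hz : δ ≤ ‖z‖) => ?_⟩
  rw [Real.coe_toNNReal _ (by positivity)]
  have hy0 : 0 < ‖y‖ := hδ.trans_le hy
  have hz0 : 0 < ‖z‖ := hδ.trans_le hz
  rw [homExt_of_ne_zero _ _ (norm_pos_iff.1 hy0), homExt_of_ne_zero _ _ (norm_pos_iff.1 hz0),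
    zpow_neg_one, zpow_neg_one]
  set a : Sph n := ⟨‖y‖⁻¹ • y, inv_norm_smul_mem_unitSphere (norm_pos_iff.1 hy0)⟩
  set b : Sph n := ⟨‖z‖⁻¹ • z, inv_norm_smul_mem_unitSphere (norm_pos_iff.1 hz0)⟩
  have h1 : |f a - f b| ≤ K * (2 / δ * dist y z) := by
    refine (hf.dist_le_mul a b).trans ?_
    gcongr
    rw [Subtype.dist_eq, dist_eq_norm, dist_eq_norm]
    exact norm_inv_norm_smul_sub_le hδ hy hz
  have h2 : |‖y‖⁻¹ - ‖z‖⁻¹| ≤ δ⁻¹ * δ⁻¹ * dist y z := by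
    have e : ‖y‖⁻¹ - ‖z‖⁻¹ = ‖y‖⁻¹ * ‖z‖⁻¹ * (‖z‖ - ‖y‖) := by field_simp
    rw [e, abs_mul, abs_of_pos (by positivity), dist_comm, dist_eq_norm]
    gcongr
    exact abs_norm_sub_norm_le z y
  have h3 : |f b| ≤ max M 0 := (hM b trivial).trans (le_max_left _ _)
  have e : ‖y‖⁻¹ * f a - ‖z‖⁻¹ * f b = ‖y‖⁻¹ * (f a - f b) + (‖y‖⁻¹ - ‖z‖⁻¹) * f b := by ring
  rw [Real.dist_eq, e]
  calc _ ≤ ‖y‖⁻¹ * |f a - f b| + |‖y‖⁻¹ - ‖z‖⁻¹| * |f b| := by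
        refine (abs_add_le _ _).trans_eq ?_
        rw [abs_mul, abs_mul, abs_of_pos (inv_pos.2 hy0)]
    _ ≤ δ⁻¹ * (K * (2 / δ * dist y z)) + δ⁻¹ * δ⁻¹ * dist y z * max M 0 := by gcongr
    _ = _ := by ring

end HomogeneousExtension

/-! ### The hypothesis on `f` in integrated form -/

/-- If a Lipschitz function `φ` satisfies `φ'(r) ≤ φ'(-r)` for `r > 0` wherever both derivatives
exist, then its even part is antitone on `(0, ∞)`. -/
theorem LipschitzWith.add_comp_neg_antitone {C : NNReal} {φ : ℝ → ℝ} (hφ : LipschitzWith C φ)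
    (hd : ∀ r : ℝ, 0 < r → DifferentiableAt ℝ φ r → DifferentiableAt ℝ φ (-r) →
      deriv φ r - deriv φ (-r) ≤ 0) {s t : ℝ} (hs : 0 < s) (hst : s ≤ t) :
    φ t + φ (-t) ≤ φ s + φ (-s) := by
  have hneg : LipschitzWith C fun r => φ (-r) := by
    refine LipschitzWith.of_dist_le_mul fun r r' => ?_
    simpa only [dist_neg_neg] using hφ.dist_le_mul (-r) (-r')
  have hg := hφ.add hneg
  have hint := (hg.lipschitzOnWith (s := Set.uIcc s t)).absolutelyContinuousOnInterval.integral_deriv_eq_sub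
  have hle : 0 ≤ ∫ r in s..t, -deriv (fun r => φ r + φ (-r)) r := by
    refine intervalIntegral.integral_nonneg_of_ae_restrict hst ?_
    refine (MeasureTheory.ae_restrict_iff' measurableSet_Icc).2 ?_
    -- By Rademacher both derivatives exist at almost every `r`. This is enough, since a Lipschitz
    -- function is absolutely continuous and so the integral of its derivative.
    filter_upwards [hφ.ae_differentiableAt_real, hneg.ae_differentiableAt_real] with r h1 h2 hr
    have h3 : DifferentiableAt ℝ φ (-r) := by
      have h2' : DifferentiableAt ℝ (fun r => φ (-r)) (- -r) := by rwa [neg_neg]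
      simpa [Function.comp_def] using h2'.comp (-r) differentiable_neg.differentiableAt
    have h4 : deriv (fun r => φ r + φ (-r)) r = deriv φ r - deriv φ (-r) := by
      rw [deriv_fun_add h1 h2, deriv_comp_neg, sub_eq_add_neg]
    have := hd r (hs.trans_le hr.1) h1 h3
    simp only [Pi.zero_apply, h4]
    linarith
  rw [intervalIntegral.integral_neg, hint] at hle
  linarith

/-- The degree `-1` extension, symmetrized under the reflection in `ξᗮ`, decreases away from the
hyperplane `ξᗮ`. -/
theorem ReflectionMonotone.add_homExt_antitone {n : ℕ} {f : Sph n → ℝ} (hf : ReflectionMonotone f)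
    {K : NNReal} (hfLip : LipschitzWith K f) (hfpos : ∀ x, 0 < f x) {ξ : Euc n} (hξ : ‖ξ‖ = 1)
    {x : Euc n} (hx : ⟪ξ, x⟫ = 0) {s t : ℝ} (hs : 0 < s) (hst : s ≤ t) :
    homExt (-1) f (x + t • ξ) + homExt (-1) f (x - t • ξ) ≤
      homExt (-1) f (x + s • ξ) + homExt (-1) f (x - s • ξ) := by
  have ht : 0 < t := hs.trans_le hst
  rcases eq_or_ne x 0 with rfl | hx0
  -- The line through the origin, where the extension is singular: both terms are positive multiples
  -- of `t⁻¹`, by positivity of `f`.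
  · have hξ0 : ξ ≠ 0 := by rintro rfl; simp at hξ
    have h1 := homExt_pos (-1) hfpos hξ0
    have h2 := homExt_pos (-1) hfpos (neg_ne_zero.2 hξ0)
    simp only [zero_add, zero_sub, ← smul_neg, homExt_smul _ f hs, homExt_smul _ f ht, zpow_neg_one]
    gcongr
  · obtain ⟨C, hC⟩ := hfLip.exists_lipschitzOnWith_homExt_neg_one (norm_pos_iff.2 hx0)
    -- By Pythagoras the line stays at distance at least `‖x‖` from the origin, where the extension
    -- is Lipschitz.
    have hline (r : ℝ) : ‖x‖ ≤ ‖x + r • ξ‖ := by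
      have h := norm_add_sq_eq_norm_sq_add_norm_sq_real
        (show ⟪x, r • ξ⟫ = 0 by rw [real_inner_smul_right, real_inner_comm, hx, mul_zero])
      nlinarith [norm_nonneg (x + r • ξ), mul_self_nonneg ‖r • ξ‖, norm_nonneg x]
    set φ : ℝ → ℝ := fun r => homExt (-1) f (x + r • ξ) with hφdef
    have hφ : LipschitzWith C φ := by
      refine LipschitzWith.of_dist_le_mul fun r r' => ?_
      refine (hC.dist_le_mul _ (hline r) _ (hline r')).trans_eq ?_
      rw [dist_add_left, dist_eq_norm, ← sub_smul, norm_smul, hξ, mul_one, dist_eq_norm]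
    have hshift (r : ℝ) : (fun s : ℝ => homExt (-1) f (x + r • ξ + s • ξ)) = fun s => φ (r + s) := by
      funext s
      simp only [hφdef, add_smul, add_assoc]
    have hdiff (r : ℝ) (hr : DifferentiableAt ℝ φ r) :
        LineDifferentiableAt ℝ (homExt (-1) f) (x + r • ξ) ξ := by
      rw [LineDifferentiableAt, hshift]
      have hr' : DifferentiableAt ℝ φ (r + 0) := by rwa [add_zero]
      exact hr'.comp (0 : ℝ) (differentiableAt_id.const_add r)
    have hderiv (r : ℝ) : lineDeriv ℝ (homExt (-1) f) (x + r • ξ) ξ = deriv φ r := by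
      rw [lineDeriv, hshift, deriv_comp_const_add, add_zero]
    have := hφ.add_comp_neg_antitone (fun r hr h1 h2 => ?_) hs hst
    · simpa only [hφdef, neg_smul, ← sub_eq_add_neg] using this
    · have h3 := hf r ξ x hr hξ (by simpa using hx) (hdiff r h1)
      rw [sub_eq_add_neg x, ← neg_smul, hderiv, hderiv] at h3
      exact h3 (hdiff _ h2)

/-! ### Convexity from a nonnegative Hessian off the origin -/

section Convexity

variable {E : Type*} [NormedAddCommGroup E] [InnerProductSpace ℝ E]

theorem le_of_iteratedFDeriv_two_nonneg_on_segment {H : E → ℝ} {x y : E}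
    (hH : ∀ z ∈ segment ℝ x y, ContDiffAt ℝ 2 H z)
    (hpos : ∀ z ∈ segment ℝ x y, ∀ v, 0 ≤ iteratedFDeriv ℝ 2 H z ![v, v]) {a b : ℝ}
    (ha : 0 ≤ a) (hb : 0 ≤ b) (hab : a + b = 1) : H (a • x + b • y) ≤ a * H x + b * H y := by
  set v := y - x with hv
  have hmem {s : ℝ} (hs : s ∈ Set.Icc (0 : ℝ) 1) : x + s • v ∈ segment ℝ x y := by
    rw [segment_eq_image']
    exact ⟨s, hs, rfl⟩
  have hd1 {s : ℝ} (hs : s ∈ Set.Icc (0 : ℝ) 1) :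
      HasDerivAt (fun r : ℝ => H (x + r • v)) (fderiv ℝ H (x + s • v) v) s :=
    hasDerivAt_comp_line ((hH _ (hmem hs)).differentiableAt (by simp))
  have hd2 {s : ℝ} (hs : s ∈ Set.Icc (0 : ℝ) 1) :
      HasDerivAt (fun r : ℝ => fderiv ℝ H (x + r • v) v)
        (iteratedFDeriv ℝ 2 H (x + s • v) ![v, v]) s := by
    have h := (hH _ (hmem hs)).hasDerivAt_fderiv_line v
    have h' : HasDerivAt (fun r : ℝ => fderiv ℝ H (x + s • v + r • v) v)
      (iteratedFDeriv ℝ 2 H (x + s • v) ![v, v]) (s - s) := by rwa [sub_self]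
    have h2 := h'.comp_sub_const s s
    simpa only [add_assoc, ← add_smul, add_sub_cancel] using h2
  have hconv : ConvexOn ℝ (Set.Icc (0 : ℝ) 1) fun r : ℝ => H (x + r • v) :=
    convexOn_of_hasDerivWithinAt2_nonneg (convex_Icc 0 1)
      (fun s hs => (hd1 hs).continuousAt.continuousWithinAt)
      (fun s hs => (hd1 (interior_subset hs)).hasDerivWithinAt)
      (fun s hs => (hd2 (interior_subset hs)).hasDerivWithinAt)
      (fun s hs => hpos _ (hmem (interior_subset hs)) v)
  have h := hconv.2 (x := 0) (y := 1) (by simp) (by simp) ha hb hab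
  have e : x + b • v = a • x + b • y := by
    rw [eq_sub_of_add_eq hab, hv]
    module
  have e1 : x + v = y := by rw [hv]; abel
  simpa [e, e1] using h

variable [FiniteDimensional ℝ E]

theorem exists_ne_zero_inner_eq_zero (hdim : 2 ≤ Module.finrank ℝ E) (v : E) :
    ∃ e : E, e ≠ 0 ∧ ⟪e, v⟫ = 0 := by
  have h1 := (ℝ ∙ v).finrank_add_finrank_orthogonal
  have h2 : Module.finrank ℝ (ℝ ∙ v) ≤ 1 := by
    simpa using finrank_span_le_card (R := ℝ) ({v} : Set E)
  have h3 : (ℝ ∙ v)ᗮ ≠ ⊥ := by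
    intro h
    rw [h, finrank_bot] at h1
    omega
  obtain ⟨e, he, he0⟩ := Submodule.exists_mem_ne_zero_of_ne_bot h3
  exact ⟨e, he0, by rw [real_inner_comm]; exact Submodule.mem_orthogonal_singleton_iff_inner_right.1 he⟩

/-- In dimension at least two, a continuous function whose second derivative is nonnegative off the
origin is convex. -/
theorem convexOn_univ_of_iteratedFDeriv_two_nonneg_off_zero (hdim : 2 ≤ Module.finrank ℝ E)
    {H : E → ℝ} (hc : Continuous H) (hH : ∀ z, z ≠ 0 → ContDiffAt ℝ 2 H z)
    (hpos : ∀ z, z ≠ 0 → ∀ v, 0 ≤ iteratedFDeriv ℝ 2 H z ![v, v]) : ConvexOn ℝ Set.univ H := by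
  refine ⟨convex_univ, fun x _ y _ a b ha hb hab => ?_⟩
  by_cases h0 : (0 : E) ∈ segment ℝ x y
  -- A segment through the origin is pushed off it in a direction `e` orthogonal to the segment;
  -- continuity then allows `δ → 0`.
  · obtain ⟨e, he0, he⟩ := exists_ne_zero_inner_eq_zero hdim (y - x)
    have hez {z : E} (hz : z ∈ segment ℝ x y) : ⟪e, z⟫ = 0 := by
      rw [segment_eq_image'] at h0 hz
      obtain ⟨s, -, hs⟩ := h0
      obtain ⟨r, -, rfl⟩ := hz
      have h1 := congrArg (fun z => ⟪e, z⟫) hs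
      simp only [inner_add_right, real_inner_smul_right, he, inner_zero_right] at h1 ⊢
      linarith
    have hshift (δ : ℝ) (hδ : 0 < δ) {z : E} (hz : z ∈ segment ℝ (x + δ • e) (y + δ • e)) :
        z ≠ 0 := by
      rintro rfl
      rw [segment_eq_image'] at hz
      obtain ⟨s, -, hs⟩ := hz
      have h1 := congrArg (fun z => ⟪e, z⟫) hs
      have h2 : ⟪e, e⟫ ≠ 0 := inner_self_ne_zero.2 he0
      simp only [add_sub_add_right_eq_sub, inner_add_right, real_inner_smul_right, he,
        hez (left_mem_segment ℝ x y), inner_zero_right, mul_zero, zero_add, add_zero] at h1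
      exact (mul_ne_zero hδ.ne' h2) h1
    have hev : ∀ᶠ δ : ℝ in 𝓝[>] 0, H (a • (x + δ • e) + b • (y + δ • e)) ≤
        a * H (x + δ • e) + b * H (y + δ • e) := by
      filter_upwards [self_mem_nhdsWithin] with δ hδ
      exact le_of_iteratedFDeriv_two_nonneg_on_segment (fun z hz => hH z (hshift δ hδ hz))
        (fun z hz => hpos z (hshift δ hδ hz)) ha hb hab
    have t1 : Continuous fun δ : ℝ => H (a • (x + δ • e) + b • (y + δ • e)) := by fun_prop
    have t2 : Continuous fun δ : ℝ => a * H (x + δ • e) + b * H (y + δ • e) := by fun_prop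
    have := le_of_tendsto_of_tendsto ((t1.tendsto 0).mono_left nhdsWithin_le_nhds)
      ((t2.tendsto 0).mono_left nhdsWithin_le_nhds) hev
    simpa using this
  · have hne {z : E} (hz : z ∈ segment ℝ x y) : z ≠ 0 := fun h => h0 (h ▸ hz)
    exact le_of_iteratedFDeriv_two_nonneg_on_segment (fun z hz => hH z (hne hz))
      (fun z hz => hpos z (hne hz)) ha hb hab

end Convexity

/-! ### Solutions of the Christoffel equation -/

section Christoffel

variable {n : ℕ}

theorem continuous_homExt_one {u : Sph n → ℝ} (hu : ContMDiff (𝓡 n) 𝓘(ℝ, ℝ) 2 u) :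
    Continuous (homExt 1 u) := by
  refine continuous_iff_continuousAt.2 fun x => ?_
  rcases eq_or_ne x 0 with rfl | hx
  · obtain ⟨M, hM⟩ := isCompact_univ.exists_bound_of_continuousOn hu.continuous.continuousOn
    rw [ContinuousAt, homExt_apply_zero]
    refine squeeze_zero_norm (a := fun y => ‖y‖ * M) (fun y => ?_) ?_
    · rcases eq_or_ne y 0 with rfl | hy
      · simp [homExt_apply_zero]
      · rw [homExt_of_ne_zero _ _ hy, zpow_one, norm_mul, norm_norm]
        gcongr
        exact hM _ trivial
    · have : Continuous fun y : Euc n => ‖y‖ * M := by fun_prop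
      simpa using this.tendsto 0
  · exact (hu.contDiffAt_homExt_one hx).continuousAt

theorem sphHessian_add_eq_iteratedFDeriv {u : Sph n → ℝ} (hu : ContMDiff (𝓡 n) 𝓘(ℝ, ℝ) 2 u)
    (x : Sph n) {ξ : Euc n} (hξ : ⟪ξ, (x : Euc n)⟫ = 0) :
    sphHessian u x ξ ξ + u x * ⟪ξ, ξ⟫ = iteratedFDeriv ℝ 2 (homExt 1 u) (x : Euc n) ![ξ, ξ] := by
  have hx : ‖(x : Euc n)‖ = 1 := by simp
  have hx0 : (x : Euc n) ≠ 0 := norm_ne_zero_iff.1 (by simp [hx])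
  rw [homExt_one_eq_norm_mul, iteratedFDeriv_two_norm_mul hx (hu.contDiffAt_homExt_zero hx0),
    real_inner_comm ξ (x : Euc n), hξ, homExt_coe, real_inner_self_eq_norm_sq, sphHessian]
  ring

/-- The extension of degree one of a solution of the Christoffel equation solves the Poisson
equation off the origin. -/
theorem IsChristoffelSolution.laplacian_homExt_one {f u : Sph n → ℝ}
    (hu : IsChristoffelSolution f u) {y : Euc n} (hy : y ≠ 0) :
    (Δ (homExt 1 u)) y = homExt (-1) f y := by
  set x : Sph n := ⟨‖y‖⁻¹ • y, inv_norm_smul_mem_unitSphere hy⟩ with hxdef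
  have hx : ‖(x : Euc n)‖ = 1 := by simp
  have hx0 : (x : Euc n) ≠ 0 := norm_ne_zero_iff.1 (by simp [hx])
  have hpos : 0 < ‖y‖ := norm_pos_iff.2 hy
  have hyx : y = ‖y‖ • (x : Euc n) := by
    rw [hxdef, smul_smul, mul_inv_cancel₀ hpos.ne', one_smul]
  have hH := hu.contMDiff.contDiffAt_homExt_one hx0
  have h1 : (Δ (homExt 1 u)) (x : Euc n) = f x := by
    rw [homExt_one_eq_norm_mul, laplacian_norm_mul_of_homogeneous_zero hx
      (hu.contMDiff.contDiffAt_homExt_zero hx0)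
      fun c hc => by rw [homExt_smul 0 u hc, zpow_zero, one_mul], homExt_coe, ← hu.eqn x]
    simp [sphLaplacian]
  have h2 : (Δ (homExt 1 u)) (‖y‖ • (x : Euc n)) = ‖y‖⁻¹ * (Δ (homExt 1 u)) (x : Euc n) := by
    simp only [InnerProductSpace.laplacian_eq_iteratedFDeriv_stdOrthonormalBasis, Finset.mul_sum]
    refine Finset.sum_congr rfl fun i _ => ?_
    refine iteratedFDeriv_two_smul_of_homogeneous_one hpos
      (fun z => by rw [homExt_smul 1 u hpos, zpow_one]) hH ?_ _
    exact hu.contMDiff.contDiffAt_homExt_one (hyx ▸ hy)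
  rw [homExt_of_ne_zero _ _ hy, zpow_neg_one, ← h1, ← h2, ← hyx]

theorem IsChristoffelSolution.iteratedFDeriv_two_nonneg (hn : 1 ≤ n) {f u : Sph n → ℝ}
    {K : NNReal} (hfLip : LipschitzWith K f) (hfpos : ∀ x, 0 < f x) (hf : ReflectionMonotone f)
    (hu : IsChristoffelSolution f u) {x : Euc n} (hx : x ≠ 0) (v : Euc n) :
    0 ≤ iteratedFDeriv ℝ 2 (homExt 1 u) x ![v, v] := by
  have hom (c : ℝ) (hc : 0 < c) (y : Euc n) : homExt 1 u (c • y) = c * homExt 1 u y := by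
    rw [homExt_smul 1 u hc, zpow_one]
  have hH (y : Euc n) (hy : y ≠ 0) : ContDiffAt ℝ 2 (homExt 1 u) y :=
    hu.contMDiff.contDiffAt_homExt_one hy
  have hunit {ξ : Euc n} (hξ : ‖ξ‖ = 1) (hξx : ⟪ξ, x⟫ = 0) :
      0 ≤ iteratedFDeriv ℝ 2 (homExt 1 u) x ![ξ, ξ] := by
    refine iteratedFDeriv_two_nonneg_of_reflection_antitone (by simpa using hn) hom hH hξ ?_ hx hξx
    intro y hy s t hs hst
    have hξξ : ⟪ξ, ξ⟫ = 1 := by rw [real_inner_self_eq_norm_sq, hξ, one_pow]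
    have hne {r : ℝ} (hr : r ≠ 0) : y + r • ξ ≠ 0 := by
      intro h
      have h1 := congrArg (fun z => ⟪ξ, z⟫) h
      simp only [inner_add_right, real_inner_smul_right, hy, hξξ, inner_zero_right] at h1
      exact hr (by linarith)
    have hne' {r : ℝ} (hr : r ≠ 0) : y - r • ξ ≠ 0 := by
      rw [sub_eq_add_neg, ← neg_smul]
      exact hne (neg_ne_zero.2 hr)
    have ht : t ≠ 0 := (hs.trans_le hst).ne'
    rw [hu.laplacian_homExt_one (hne ht), hu.laplacian_homExt_one (hne' ht),
      hu.laplacian_homExt_one (hne hs.ne'), hu.laplacian_homExt_one (hne' hs.ne')]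
    exact hf.add_homExt_antitone hfLip hfpos hξ hy hs hst
  -- The radial part of `v` does not contribute; the tangential part is normalised to a unit vector.
  obtain ⟨w, a, hw, rfl⟩ : ∃ (w : Euc n) (a : ℝ), ⟪w, x⟫ = 0 ∧ v = w + a • x := by
    refine ⟨v - (⟪v, x⟫ / ⟪x, x⟫) • x, ⟪v, x⟫ / ⟪x, x⟫, ?_, by module⟩
    rw [inner_sub_left, real_inner_smul_left, div_mul_cancel₀ _ (inner_self_ne_zero.2 hx), sub_self]
  rw [iteratedFDeriv_two_add_smul_self_of_homogeneous_one hom (hH x hx)]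
  rcases eq_or_ne w 0 with rfl | hw0
  · simp [iteratedFDeriv_two_apply]
  · have h := hunit (ξ := ‖w‖⁻¹ • w) (by simp [norm_smul, hw0])
      (by rw [real_inner_smul_left, hw, mul_zero])
    simp only [iteratedFDeriv_two_apply, Matrix.cons_val_zero, Matrix.cons_val_one, map_smul,
      smul_apply, smul_eq_mul] at h ⊢
    have hp : 0 < ‖w‖⁻¹ := by positivity
    exact nonneg_of_mul_nonneg_right (nonneg_of_mul_nonneg_right h hp) hp

end Christoffel

theorem theorem3p3 (n : ℕ) (hn : 2 ≤ n) (f : Sph n → ℝ)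
    (hfLip : ∃ K : NNReal, LipschitzWith K f) (hfpos : ∀ x, 0 < f x)
    (hf : ReflectionMonotone f)
    (u : Sph n → ℝ) (hu : IsChristoffelSolution f u) :
    IsConvexOnSphere u := by
  obtain ⟨K, hK⟩ := hfLip
  have hn1 : 1 ≤ n := by omega
  refine ⟨?_, fun x ξ hξ => ?_⟩
  · exact convexOn_univ_of_iteratedFDeriv_two_nonneg_off_zero (by simpa using hn1)
      (continuous_homExt_one hu.contMDiff) (fun z hz => hu.contMDiff.contDiffAt_homExt_one hz)
      fun z hz v => hu.iteratedFDeriv_two_nonneg hn1 hK hfpos hf hz v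
  · rw [sphHessian_add_eq_iteratedFDeriv hu.contMDiff x hξ]
    have hx0 : (x : Euc n) ≠ 0 := norm_ne_zero_iff.1 (by simp)
    exact hu.iteratedFDeriv_two_nonneg hn1 hK hfpos hf hx0 ξ
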